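/- Let $\mathbb D=\{z\in\mathbb C:|z|<1\}$, $\mathbb T=\partial\mathbb D$, and let $d\mathcal A=\frac{dx\,dy}{\pi}$ be the normalized area measure on $\mathbb D$. For $\alpha>-1$ put $d\mathcal A_\alpha(z)=(\alpha+1)(1-|z|^2)^\alpha\,d\mathcal A(z)$. For $\xi\in\mathbb T$ and $0<h<1$ let $$W(\xi,h)=\{z\in\mathbb D:\ |z|\ge 1-h\ \text{ and }\ |\arg(z\bar\xi)|\le h\}$$ be the Carleson window centered at $\xi$ and of size $h$, where $\arg$ is the principal argument, with values in $(-\pi,\pi]$. **Theorem.** For each $\alpha>-1$ there is a constant $C_\alpha>0$, depending only on $\alpha$, such that for every analytic map $\varphi:\mathbb D\to\mathbb D$ there is $h_0\in(0,1]$, depending only on $\alpha$ and $\varphi$, such that, for every $\varepsilon\in(0,1)$, every $h\in(0,h_0)$ and every $\xi\in\mathbb T$, $$\mathcal A_\alpha\big(\{z\in\mathbb D:\varphi(z)\in W(\xi,\varepsilon h)\}\big)\le C_\alpha\,\varepsilon^{\alpha+2}\,\mathcal A_\alpha\big(\{z\in\mathbb D:\varphi(z)\in W(\xi,h)\}\big).$$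 -/

import Mathlib

open MeasureTheory

noncomputable section

/-- The open unit disk `{z : |z| < 1}` of the complex plane. -/
def unitDisk : Set ℂ := {z : ℂ | ‖z‖ < 1}

/-- The normalized area measure `dx dy / π` on the unit disk, seen as a measure on `ℂ` carried
by the disk. -/
def normalizedArea : Measure ℂ :=
  ENNReal.ofReal (1 / Real.pi) • (volume : Measure ℂ).restrict unitDisk

/-- The weighted measure `(α + 1) (1 - |z|²)^α` times the normalized area measure on the disk. -/
def weightedArea (α : ℝ) : Measure ℂ :=
  normalizedArea.withDensity (fun z => ENNReal.ofReal ((α + 1) * (1 - ‖z‖ ^ 2) ^ α))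

/-- The Carleson window centered at `ξ` (on the unit circle) and of size `h`, `0 < h < 1`. -/
def carlesonWindow (ξ : ℂ) (h : ℝ) : Set ℂ :=
  {z : ℂ | z ∈ unitDisk ∧ 1 - h ≤ ‖z‖ ∧ |Complex.arg (z * (starRingEnd ℂ) ξ)| ≤ h}

/-- `φ` is an analytic self-map of the unit disk (its values outside the disk play no role). -/
def IsAnalyticSelfMap (φ : ℂ → ℂ) : Prop :=
  AnalyticOnNhd ℂ φ unitDisk ∧ Set.MapsTo φ unitDisk unitDisk

end

/-!
After rotating `ξ` to `1`, the window `W(ξ, h)` is comparable to `{|1 - w| ≤ h}` on the unit disk,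
so the statement concerns the size of `f = (h / 16) / (1 - conj ξ * φ)`, an analytic map of the
disk into the right half-plane: `φ ∈ W(ξ, ε h)` forces `|f| ≥ 1 / (32 ε)`, and `|f| ≥ 1 / 4` forces
`φ ∈ W(ξ, h)`. For `h < 1 - |φ 0|` one has `|f 0| ≤ 1`, and the claim becomes the weak-type estimate
`A_α(|f| ≥ L) ≤ C L ^ (-(α + 2)) A_α(|f| ≥ 1 / 4)` (`exists_weightedArea_le_norm`). Values of `ε`
bounded below are trivial, as the windows increase with their size.

The size of `f` is read off the nonnegative harmonic functions `u = Re (f / (f + L))`, which satisfy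
`u ≤ |f| / L` everywhere and `u ≥ 1 / 2` where `|f| ≥ L`. Let `|f a| = 1` and `δ = 1 - |a|`, so that
`u a ≤ 1 / L`. Comparing Poisson kernels shows that, within distance `5 δ` of `a`, the set
`{|f| ≥ L}` lies in an annulus of width `O(δ / L)` at the unit circle, and that it meets each circle
of that annulus in angles of total measure `O(δ / L)`. In polar coordinates this gives weighted area
`O((δ / L) ^ (α + 2))` (`weightedArea_closedBall_le`). On the other hand Harnack's inequality gives
`|f| ≥ 1 / 4` on the ball of radius `δ / 4` about `a`, whose weighted area is at least a constant
times `δ ^ (α + 2)` (`le_weightedArea_closedBall_quarter`). Vitali's covering lemma, for the balls of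
centre `a` and radius `1 - |a|`, adds up these local comparisons.
-/

open Metric InnerProductSpace

/-! ### The map `w ↦ Re (w / (w + L))` on the right half-plane -/

lemma re_div_add_eq (w : ℂ) (L : ℝ) :
    (w / (w + L)).re = (‖w‖ ^ 2 + L * w.re) / ‖w + L‖ ^ 2 := by
  rw [Complex.div_re, ← Complex.normSq_eq_norm_sq, ← Complex.normSq_eq_norm_sq, ← add_div,
    Complex.normSq_apply w]
  simp only [Complex.add_re, Complex.add_im, Complex.ofReal_re, Complex.ofReal_im]
  ring

lemma norm_add_ofReal_sq (w : ℂ) (L : ℝ) :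
    ‖w + L‖ ^ 2 = ‖w‖ ^ 2 + 2 * L * w.re + L ^ 2 := by
  rw [← Complex.normSq_eq_norm_sq, ← Complex.normSq_eq_norm_sq, Complex.normSq_apply,
    Complex.normSq_apply w]
  simp only [Complex.add_re, Complex.add_im, Complex.ofReal_re, Complex.ofReal_im]
  ring

lemma add_ofReal_ne_zero {w : ℂ} (hw : 0 < w.re) {L : ℝ} (hL : 0 < L) : w + L ≠ 0 := by
  intro h
  have := congrArg Complex.re h
  simp at this
  linarith

lemma re_div_add_nonneg {w : ℂ} (hw : 0 < w.re) {L : ℝ} (hL : 0 < L) :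
    0 ≤ (w / (w + L)).re := by
  rw [re_div_add_eq]; positivity

lemma re_div_add_le {w : ℂ} (hw : 0 < w.re) {L : ℝ} (hL : 0 < L) :
    (w / (w + L)).re ≤ ‖w‖ / L := by
  refine (Complex.re_le_norm _).trans ?_
  rw [norm_div]
  gcongr
  refine le_trans ?_ (Complex.re_le_norm _)
  simp [hw.le]

lemma half_le_re_div_add {w : ℂ} (hw : 0 < w.re) {L : ℝ} (hL : 0 < L) (h : L ≤ ‖w‖) :
    1 / 2 ≤ (w / (w + L)).re := by
  have h0 : 0 < ‖w + L‖ ^ 2 := by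
    have := norm_pos_iff.2 (add_ofReal_ne_zero hw hL)
    positivity
  rw [re_div_add_eq, div_le_div_iff₀ two_pos h0, norm_add_ofReal_sq]
  nlinarith

lemma harmonicOnNhd_re_div_add {f : ℂ → ℂ} {s : Set ℂ} (hf : AnalyticOnNhd ℂ f s)
    (hre : ∀ z ∈ s, 0 < (f z).re) {L : ℝ} (hL : 0 < L) :
    HarmonicOnNhd (fun z => (f z / (f z + L)).re) s := by
  intro z hz
  have := (hf z hz).div ((hf z hz).add analyticAt_const) (add_ofReal_ne_zero (hre z hz) hL)
  exact this.harmonicAt_re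

/-! ### Harnack inequalities from the Poisson integral -/

lemma circleIntegrable_poissonKernel_smul {u : ℂ → ℝ} {c w : ℂ} {R : ℝ}
    (hu : HarmonicOnNhd u (closedBall c R)) (hw : w ∈ ball c R) :
    CircleIntegrable (poissonKernel c w • u) c R := by
  have hR : 0 < R := pos_of_mem_ball hw
  apply ContinuousOn.circleIntegrable hR.le
  have h1 : ContinuousOn (poissonKernel c w) (sphere c R) := by
    rw [poissonKernel_eq_re_herglotzRieszKernel]
    have := continuousOn_herglotzRieszKernel_sphere hw
    rw [abs_of_pos hR] at this
    exact Complex.continuous_re.comp_continuousOn this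
  refine h1.smul fun x hx => ?_
  exact (hu x (sphere_subset_closedBall hx)).1.continuousAt.continuousWithinAt

/-- Two values of a nonnegative harmonic function compare as the Poisson kernels of the two
points do. -/
lemma InnerProductSpace.HarmonicOnNhd.le_mul_of_poissonKernel_le {u : ℂ → ℝ} {c a b : ℂ} {R K : ℝ}
    (hu : HarmonicOnNhd u (closedBall c R)) (h0 : ∀ z ∈ sphere c R, 0 ≤ u z)
    (ha : a ∈ ball c R) (hb : b ∈ ball c R)
    (hK : ∀ z ∈ sphere c R, poissonKernel c a z ≤ K * poissonKernel c b z) :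
    u a ≤ K * u b := by
  have hR : 0 < R := pos_of_mem_ball ha
  rw [← hu.circleAverage_poissonKernel_smul ha, ← hu.circleAverage_poissonKernel_smul hb,
    ← smul_eq_mul, ← Real.circleAverage_fun_smul]
  refine Real.circleAverage_mono (circleIntegrable_poissonKernel_smul hu ha) ?_ fun z hz => ?_
  · exact (circleIntegrable_poissonKernel_smul hu hb).const_smul
  · rw [abs_of_pos hR] at hz
    have := mul_le_mul_of_nonneg_right (hK z hz) (h0 z hz)
    simpa [mul_assoc] using this

/-- Harnack's inequality, for a point at distance at most a third of the radius from the centre. -/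
lemma InnerProductSpace.HarmonicOnNhd.center_le_two_mul {u : ℂ → ℝ} {c w : ℂ} {R : ℝ}
    (hu : HarmonicOnNhd u (closedBall c R)) (h0 : ∀ z ∈ sphere c R, 0 ≤ u z) (hR : 0 < R)
    (hw : ‖w - c‖ ≤ R / 3) : u c ≤ 2 * u w := by
  have hwb : w ∈ ball c R := by rw [mem_ball_iff_norm]; linarith
  refine HarmonicOnNhd.le_mul_of_poissonKernel_le hu h0 (mem_ball_self hR) hwb fun z hz => ?_
  have h1 := le_re_herglotzRieszKernel hz hwb
  have h2 : poissonKernel c c z = 1 := by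
    have : ‖z - c‖ = R := by simpa [dist_eq_norm] using hz
    rw [poissonKernel_def]
    simp [this, hR.ne']
  rw [h2, poissonKernel_eq_re_herglotzRieszKernel, Function.comp_apply, herglotzRieszKernel_def]
  have h3 : 1 / 2 ≤ (R - ‖w - c‖) / (R + ‖w - c‖) := by
    rw [div_le_div_iff₀ two_pos (by positivity)]; linarith
  linarith

/-- Harnack's inequality near the unit circle: for `z` within `5 (1 - |a|)` of `a`, a nonnegative
harmonic function on the disk satisfies `u z ≤ 1152 (1 - |a|) / (1 - |z|) * u a`. -/
lemma InnerProductSpace.HarmonicOnNhd.mul_le_of_mem_closedBall {u : ℂ → ℝ} {a z : ℂ}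
    (hu : HarmonicOnNhd u (ball 0 1)) (h0 : ∀ z ∈ ball (0 : ℂ) 1, 0 ≤ u z)
    (ha : ‖a‖ < 1) (hz : ‖z‖ < 1) (haz : ‖z - a‖ ≤ 5 * (1 - ‖a‖)) :
    (1 - ‖z‖) * u z ≤ 1152 * (1 - ‖a‖) * u a := by
  set δ := 1 - ‖a‖ with hδ
  set s := 1 - ‖z‖ with hs
  have hδ0 : 0 < δ := by linarith
  have hs0 : 0 < s := by linarith
  have hδ1 : δ ≤ 1 := by linarith [norm_nonneg a]
  have hsδ : s ≤ 6 * δ := by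
    have := norm_sub_norm_le a z
    rw [norm_sub_rev] at this
    linarith
  -- the radius is chosen so that `1 - r` is at most `δ / 2` and at most `s / 12`
  set r := 1 - s / 12 with hr
  have hr1 : r < 1 := by linarith
  have hsub : closedBall (0 : ℂ) r ⊆ ball 0 1 := closedBall_subset_ball hr1
  have har : a ∈ ball (0 : ℂ) r := by rw [mem_ball_zero_iff]; linarith
  have hzr : z ∈ ball (0 : ℂ) r := by rw [mem_ball_zero_iff]; linarith
  have key : u z ≤ (1152 * δ / s) * u a := by
    refine HarmonicOnNhd.le_mul_of_poissonKernel_le (c := 0) (R := r) (fun x hx => hu x (hsub hx))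
      (fun x hx => h0 x (hsub (sphere_subset_closedBall hx))) hzr har fun ζ hζ => ?_
    have hζr : ‖ζ‖ = r := by simpa using hζ
    simp only [poissonKernel_def, sub_zero, hζr]
    have d1 : 11 * s / 12 ≤ ‖ζ - z‖ := by
      have := norm_sub_norm_le ζ z; linarith
    have d2 : ‖ζ - a‖ ≤ 12 * δ / s * ‖ζ - z‖ := by
      have h1 : ‖ζ - a‖ ≤ ‖ζ - z‖ + 5 * δ := by
        have : ζ - a = (ζ - z) + (z - a) := by ring
        rw [this]; exact (norm_add_le _ _).trans (by linarith)
      have h2 : 1 ≤ 6 * δ / s := by rw [le_div_iff₀ hs0]; linarith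
      have h3 : 5 * δ ≤ 6 * δ / s * ‖ζ - z‖ := by
        calc 5 * δ ≤ 6 * δ / s * (11 * s / 12) := by field_simp; linarith
          _ ≤ _ := by gcongr
      have h4 : ‖ζ - z‖ ≤ 6 * δ / s * ‖ζ - z‖ := le_mul_of_one_le_left (norm_nonneg _) h2
      calc ‖ζ - a‖ ≤ 6 * δ / s * ‖ζ - z‖ + 6 * δ / s * ‖ζ - z‖ := by linarith
        _ = _ := by ring
    have d3 : 0 < ‖ζ - z‖ := by linarith
    have d4 : 0 < ‖ζ - a‖ := by
      have := norm_sub_norm_le ζ a; linarith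
    have e1 : r ^ 2 - ‖z‖ ^ 2 ≤ 2 * s := by
      have : r ^ 2 - ‖z‖ ^ 2 = (r - ‖z‖) * (r + ‖z‖) := by ring
      rw [this]
      have : r - ‖z‖ ≤ s := by linarith
      have : r + ‖z‖ ≤ 2 := by linarith
      have : 0 ≤ r + ‖z‖ := by linarith [norm_nonneg z]
      nlinarith
    have e2 : δ / 4 ≤ r ^ 2 - ‖a‖ ^ 2 := by
      have : r ^ 2 - ‖a‖ ^ 2 = (r - ‖a‖) * (r + ‖a‖) := by ring
      rw [this]
      have : δ / 2 ≤ r - ‖a‖ := by linarith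
      have : 1 / 2 ≤ r + ‖a‖ := by linarith [norm_nonneg a]
      nlinarith
    have e3 : 0 ≤ r ^ 2 - ‖a‖ ^ 2 := by linarith
    rw [div_le_iff₀ (by positivity)]
    calc r ^ 2 - ‖z‖ ^ 2 ≤ 2 * s := e1
      _ = 1152 * δ / s * ((δ / 4) / (12 * δ / s * ‖ζ - z‖) ^ 2) * ‖ζ - z‖ ^ 2 := by
          field_simp; norm_num
      _ ≤ 1152 * δ / s * ((r ^ 2 - ‖a‖ ^ 2) / ‖ζ - a‖ ^ 2) * ‖ζ - z‖ ^ 2 := by gcongr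
  calc s * u z ≤ s * ((1152 * δ / s) * u a) := by gcongr
    _ = _ := by field_simp

/-- A weak-type estimate on circles: the Poisson kernel at `a` has size at least `1 / (100 δ)`,
`δ = 1 - |a|`, on the part within `5 δ` of `a` of a circle of radius `r ≥ 1 - δ / 2`, so that a
nonnegative harmonic function can be large there only on a small set of angles. -/
lemma InnerProductSpace.HarmonicOnNhd.volume_circle_le {u : ℂ → ℝ} {a : ℂ} {r : ℝ}
    (hu : HarmonicOnNhd u (ball 0 1)) (h0 : ∀ z ∈ ball (0 : ℂ) 1, 0 ≤ u z)
    (ha : ‖a‖ < 1) (hr1 : r < 1) (hr : 1 - r ≤ (1 - ‖a‖) / 2) :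
    volume {θ ∈ Set.Ioo (-Real.pi) Real.pi | circleMap 0 r θ ∈ closedBall a (5 * (1 - ‖a‖)) ∧
      1 / 2 ≤ u (circleMap 0 r θ)} ≤ ENNReal.ofReal (400 * Real.pi * (1 - ‖a‖) * u a) := by
  set δ := 1 - ‖a‖ with hδ
  have hδ0 : 0 < δ := by linarith
  have hδ1 : δ ≤ 1 := by linarith [norm_nonneg a]
  have hr2 : 1 / 2 ≤ r := by linarith
  have hr0 : 0 < r := by linarith
  have har : a ∈ ball (0 : ℂ) r := by rw [mem_ball_zero_iff]; linarith
  have hsub : closedBall (0 : ℂ) r ⊆ ball 0 1 := closedBall_subset_ball hr1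
  have hur : HarmonicOnNhd u (closedBall 0 r) := fun x hx => hu x (hsub hx)
  have hcirc : ∀ θ, circleMap 0 r θ ∈ sphere (0 : ℂ) r := fun θ => circleMap_mem_sphere 0 hr0.le θ
  have hgap : δ / 4 ≤ r ^ 2 - ‖a‖ ^ 2 := by
    have : r ^ 2 - ‖a‖ ^ 2 = (r - ‖a‖) * (r + ‖a‖) := by ring
    rw [this]
    have : δ / 2 ≤ r - ‖a‖ := by linarith
    have : 1 / 2 ≤ r + ‖a‖ := by linarith [norm_nonneg a]
    nlinarith
  have hint := circleIntegrable_poissonKernel_smul hur har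
  set g : ℝ → ℝ := fun θ => (poissonKernel 0 a • u) (circleMap 0 r θ) with hg
  have hper : Function.Periodic g (2 * Real.pi) := fun θ => by
    simp [hg, periodic_circleMap 0 r θ]
  have hgint : IntervalIntegrable g volume (-Real.pi) Real.pi := by
    have h1 : IntervalIntegrable g volume 0 (0 + 2 * Real.pi) := by
      rw [zero_add]; exact hint
    exact hper.intervalIntegrable Real.two_pi_pos.ne' h1 _ _
  have hg0 : ∀ θ, 0 ≤ g θ := fun θ => by
    have hn : ‖circleMap 0 r θ‖ = r := by simpa using hcirc θ
    have h1 : 0 ≤ poissonKernel 0 a (circleMap 0 r θ) := by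
      rw [poissonKernel_def]
      simp only [sub_zero, hn]
      have : 0 ≤ r ^ 2 - ‖a‖ ^ 2 := by linarith
      positivity
    exact mul_nonneg h1 (h0 _ (hsub (sphere_subset_closedBall (hcirc θ))))
  have hval : ∫ θ in Set.Ioc (-Real.pi) Real.pi, g θ = 2 * Real.pi * u a := by
    have h1 := hur.circleAverage_poissonKernel_smul har
    rw [Real.circleAverage_def] at h1
    have h2 : ∫ θ in (-Real.pi)..Real.pi, g θ = ∫ θ in (0 : ℝ)..(2 * Real.pi), g θ := by
      have := hper.intervalIntegral_add_eq (-Real.pi) 0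
      rw [show -Real.pi + 2 * Real.pi = Real.pi by ring, zero_add] at this
      exact this
    rw [← intervalIntegral.integral_of_le (by linarith [Real.pi_pos]), h2, ← h1, smul_eq_mul]
    have := Real.pi_pos
    field_simp
    rfl
  have hmarkov := mul_meas_ge_le_integral_of_nonneg (μ := volume.restrict
    (Set.Ioc (-Real.pi) Real.pi)) (ae_of_all _ hg0)
    ((intervalIntegrable_iff_integrableOn_Ioc_of_le (by linarith [Real.pi_pos])).1 hgint)
    (1 / (200 * δ))
  rw [hval] at hmarkov
  have hle : volume {θ ∈ Set.Ioo (-Real.pi) Real.pi |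
      circleMap 0 r θ ∈ closedBall a (5 * δ) ∧ 1 / 2 ≤ u (circleMap 0 r θ)} ≤
      (volume.restrict (Set.Ioc (-Real.pi) Real.pi)) {θ | 1 / (200 * δ) ≤ g θ} := by
    rw [Measure.restrict_apply' measurableSet_Ioc]
    refine measure_mono fun θ ⟨h1, h2, h3⟩ => ⟨?_, Set.Ioo_subset_Ioc_self h1⟩
    have hn : ‖circleMap 0 r θ‖ = r := by simpa using hcirc θ
    have hd : ‖circleMap 0 r θ - a‖ ≤ 5 * δ := by rwa [← mem_closedBall_iff_norm]
    have hd0 : 0 < ‖circleMap 0 r θ - a‖ := by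
      have := norm_sub_norm_le (circleMap 0 r θ) a; linarith
    have hp : 1 / (100 * δ) ≤ poissonKernel 0 a (circleMap 0 r θ) := by
      rw [poissonKernel_def]
      simp only [sub_zero, hn]
      rw [div_le_div_iff₀ (by positivity) (by positivity)]
      nlinarith
    calc 1 / (200 * δ) = 1 / (100 * δ) * (1 / 2) := by field_simp; norm_num
      _ ≤ g θ := mul_le_mul hp h3 (by norm_num) (le_trans (by positivity) hp)
  refine hle.trans ?_
  rw [← ENNReal.ofReal_toReal (measure_ne_top _ _)]
  refine ENNReal.ofReal_le_ofReal ?_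
  change (volume.restrict (Set.Ioc (-Real.pi) Real.pi)).real _ ≤ _
  rw [div_mul_eq_mul_div, one_mul, div_le_iff₀ (by positivity)] at hmarkov
  linarith

/-! ### Weighted area in polar coordinates -/

lemma lintegral_one_sub_rpow {α s : ℝ} (hα : -1 < α) (hs : 0 ≤ s) :
    ∫⁻ r in Set.Ico (1 - s) 1, ENNReal.ofReal ((1 - r) ^ α) =
      ENNReal.ofReal (s ^ (α + 1) / (α + 1)) := by
  have hint : IntervalIntegrable (fun r : ℝ => (1 - r) ^ α) volume (1 - s) 1 := by
    have := (intervalIntegral.intervalIntegrable_rpow' hα (a := 0) (b := s)).comp_sub_left 1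
    simpa using this.symm
  have hle : 1 - s ≤ 1 := by linarith
  rw [Measure.restrict_congr_set Ico_ae_eq_Ioc, ← ofReal_integral_eq_lintegral_ofReal
    ((intervalIntegrable_iff_integrableOn_Ioc_of_le hle).1 hint),
    ← intervalIntegral.integral_of_le hle,
    intervalIntegral.integral_comp_sub_left (fun t : ℝ => t ^ α) 1, integral_rpow (Or.inl hα)]
  · have : α + 1 ≠ 0 := by linarith
    simp [Real.zero_rpow this]
  · refine (ae_restrict_iff' measurableSet_Ioc).2 (ae_of_all _ fun r hr => ?_)
    exact Real.rpow_nonneg (by linarith [hr.2]) _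

lemma isOpen_unitDisk : IsOpen unitDisk := isOpen_lt continuous_norm continuous_const

lemma weightedArea_eq {α : ℝ} {S : Set ℂ} (hS : MeasurableSet S) (hSD : S ⊆ unitDisk) :
    weightedArea α S = ∫⁻ z in S, ENNReal.ofReal (1 / Real.pi) *
      ENNReal.ofReal ((α + 1) * (1 - ‖z‖ ^ 2) ^ α) := by
  rw [weightedArea, withDensity_apply _ hS, normalizedArea, Measure.restrict_smul,
    Measure.restrict_restrict hS, Set.inter_eq_left.2 hSD, lintegral_smul_measure,
    lintegral_const_mul' _ _ ENNReal.ofReal_ne_top, smul_eq_mul]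

lemma one_sub_sq_rpow_le {α r : ℝ} (h0 : 0 < r) (h1 : r < 1) :
    (1 - r ^ 2) ^ α ≤ max 1 (2 ^ α) * (1 - r) ^ α := by
  have : 1 - r ^ 2 = (1 + r) * (1 - r) := by ring
  rw [this, Real.mul_rpow (by linarith) (by linarith)]
  refine mul_le_mul_of_nonneg_right ?_ (Real.rpow_nonneg (by linarith) _)
  rcases le_total 0 α with h | h
  · exact le_max_of_le_right (Real.rpow_le_rpow (by linarith) (by linarith) h)
  · exact le_max_of_le_left (Real.rpow_le_one_of_one_le_of_nonpos (by linarith) h)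

/-- Polar coordinates: a set in the annulus `1 - s ≤ |z| < 1` that meets each circle in angles of
total measure at most `M` has weighted area at most a constant times `s ^ (α + 1) * M`. -/
lemma weightedArea_le_of_volume_circle_le {α : ℝ} (hα : -1 < α) {S : Set ℂ}
    (hS : MeasurableSet S) (hSD : S ⊆ unitDisk) {s M : ℝ} (hs : 0 ≤ s)
    (hSs : ∀ z ∈ S, 1 - ‖z‖ ≤ s)
    (hM : ∀ r, 0 < r → 1 - s ≤ r → r < 1 →
      volume {θ ∈ Set.Ioo (-Real.pi) Real.pi | circleMap 0 r θ ∈ S} ≤ ENNReal.ofReal M) :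
    weightedArea α S ≤ ENNReal.ofReal (max 1 (2 ^ α) / Real.pi * s ^ (α + 1) * M) := by
  have hα1 : 0 < α + 1 := by linarith
  have hc : (0 : ℝ) < max 1 (2 ^ α) := lt_max_of_lt_left one_pos
  have hpi := Real.pi_pos
  set w : ℝ → ENNReal := fun r => ENNReal.ofReal (1 / Real.pi) *
      ENNReal.ofReal ((α + 1) * (1 - r ^ 2) ^ α) with hw
  have hwm : Measurable w := by
    apply Measurable.const_mul
    fun_prop
  set F : ℂ → ENNReal := S.indicator fun z => w ‖z‖ with hF
  have hFm : Measurable F := (hwm.comp measurable_norm).indicator hS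
  have hpolar : ∀ p : ℝ × ℝ, Complex.polarCoord.symm p = circleMap 0 p.1 p.2 := fun p => by
    rw [Complex.polarCoord_symm_apply, circleMap, zero_add, Complex.exp_mul_I]
    simp
  have hmap : Measurable fun p : ℝ × ℝ => circleMap 0 p.1 p.2 := by
    unfold circleMap; fun_prop
  rw [weightedArea_eq hS hSD, ← lintegral_indicator hS]
  change ∫⁻ z, F z ≤ _
  rw [← Complex.lintegral_comp_polarCoord_symm, polarCoord_target, Measure.volume_eq_prod,
    ← Measure.prod_restrict]
  simp only [hpolar, smul_eq_mul]
  rw [lintegral_prod _ (by fun_prop)]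
  have hinner : ∀ r ∈ Set.Ioi (0 : ℝ), ∫⁻ θ in Set.Ioo (-Real.pi) Real.pi,
      ENNReal.ofReal r * F (circleMap 0 r θ) ≤ (Set.Ico (1 - s) 1).indicator (fun r =>
        ENNReal.ofReal (max 1 (2 ^ α) / Real.pi * (α + 1) * M) *
          ENNReal.ofReal ((1 - r) ^ α)) r := by
    intro r hr
    have hr0 : 0 < r := hr
    have hnorm : ∀ θ, ‖circleMap 0 r θ‖ = r := fun θ => by simp [abs_of_pos hr0]
    by_cases hrs : r ∈ Set.Ico (1 - s) 1
    · rw [Set.indicator_of_mem hrs]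
      have hTm : MeasurableSet {θ : ℝ | circleMap 0 r θ ∈ S} :=
        (continuous_circleMap 0 r).measurable hS
      have heq : ∀ θ, ENNReal.ofReal r * F (circleMap 0 r θ) =
          {θ : ℝ | circleMap 0 r θ ∈ S}.indicator (fun _ => ENNReal.ofReal r * w r) θ := by
        intro θ
        by_cases h : circleMap 0 r θ ∈ S
        · simp [hF, h, hnorm, Set.indicator]
        · simp [hF, h, Set.indicator]
      simp only [heq]
      rw [lintegral_indicator_const hTm, Measure.restrict_apply hTm, Set.inter_comm]
      refine (mul_le_mul_right (hM r hr0 hrs.1 hrs.2) _).trans ?_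
      have h1r : 0 ≤ (1 - r) ^ α := Real.rpow_nonneg (by linarith [hrs.2]) _
      have hwr : ENNReal.ofReal r * w r ≤
          ENNReal.ofReal (max 1 (2 ^ α) / Real.pi * (α + 1)) * ENNReal.ofReal ((1 - r) ^ α) := by
        simp only [hw]
        rw [← ENNReal.ofReal_mul (by positivity), ← ENNReal.ofReal_mul hr0.le,
          ← ENNReal.ofReal_mul (by positivity)]
        refine ENNReal.ofReal_le_ofReal ?_
        have := one_sub_sq_rpow_le (α := α) hr0 hrs.2
        have h2 : 0 ≤ (1 - r ^ 2) ^ α := Real.rpow_nonneg (by nlinarith [hrs.2]) _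
        calc r * (1 / Real.pi * ((α + 1) * (1 - r ^ 2) ^ α))
            ≤ 1 * (1 / Real.pi * ((α + 1) * (max 1 (2 ^ α) * (1 - r) ^ α))) := by
              gcongr
              exact hrs.2.le
          _ = _ := by ring
      refine (mul_le_mul_left hwr _).trans ?_
      rw [ENNReal.ofReal_mul (p := max 1 (2 ^ α) / Real.pi * (α + 1)) (by positivity)]
      exact le_of_eq (by ring)
    · rw [Set.indicator_of_notMem hrs, nonpos_iff_eq_zero]
      have : ∀ θ, F (circleMap 0 r θ) = 0 := fun θ => by
        refine Set.indicator_of_notMem (fun h => hrs ⟨?_, ?_⟩) _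
        · have := hSs _ h; rw [hnorm] at this; linarith
        · have : ‖circleMap 0 r θ‖ < 1 := hSD h
          rwa [hnorm] at this
      simp [this]
  calc _ ≤ ∫⁻ r in Set.Ioi (0 : ℝ), (Set.Ico (1 - s) 1).indicator (fun r =>
        ENNReal.ofReal (max 1 (2 ^ α) / Real.pi * (α + 1) * M) *
          ENNReal.ofReal ((1 - r) ^ α)) r := setLIntegral_mono' measurableSet_Ioi hinner
    _ ≤ ∫⁻ r, (Set.Ico (1 - s) 1).indicator (fun r =>
        ENNReal.ofReal (max 1 (2 ^ α) / Real.pi * (α + 1) * M) *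
          ENNReal.ofReal ((1 - r) ^ α)) r := setLIntegral_le_lintegral _ _
    _ = ENNReal.ofReal (max 1 (2 ^ α) / Real.pi * s ^ (α + 1) * M) := by
      rw [lintegral_indicator measurableSet_Ico, lintegral_const_mul' _ _ ENNReal.ofReal_ne_top,
        lintegral_one_sub_rpow hα hs, mul_comm, ← ENNReal.ofReal_mul (by positivity)]
      congr 1
      field_simp

/-! ### The weak-type estimate for maps into the right half-plane -/

lemma unitDisk_eq_ball : unitDisk = ball (0 : ℂ) 1 := by
  ext z; simp [unitDisk]

lemma measurableSet_le_norm {f : ℂ → ℂ} (hf : ContinuousOn f unitDisk) (L : ℝ) :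
    MeasurableSet {z | z ∈ unitDisk ∧ L ≤ ‖f z‖} := by
  obtain ⟨t, ht, h⟩ := continuousOn_iff_isClosed.1 hf.norm (Set.Ici L) isClosed_Ici
  have : {z | z ∈ unitDisk ∧ L ≤ ‖f z‖} = t ∩ unitDisk := by
    rw [← h]; ext z; simp [and_comm]
  rw [this]
  exact ht.measurableSet.inter isOpen_unitDisk.measurableSet

/-- The weak-type estimate on the part of the disk within `5 δ` of `a`, `δ = 1 - |a|`. By Harnack's
inequality `|f|` exceeds `L` only in the annulus `1 - |z| ≤ 2304 δ / L`, and on each circle of that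
annulus it does so on a set of angles of measure at most `400 π δ / L`. -/
lemma weightedArea_closedBall_le {α : ℝ} (hα : -1 < α) {f : ℂ → ℂ}
    (hf : AnalyticOnNhd ℂ f unitDisk) (hre : ∀ z ∈ unitDisk, 0 < (f z).re) {a : ℂ}
    (ha : a ∈ unitDisk) (hfa : ‖f a‖ = 1) {L : ℝ} (hL : 4608 ≤ L) :
    weightedArea α ({z | z ∈ unitDisk ∧ L ≤ ‖f z‖} ∩ closedBall a (5 * (1 - ‖a‖))) ≤
      ENNReal.ofReal (max 1 (2 ^ α) * 2304 ^ (α + 1) * 400 * ((1 - ‖a‖) / L) ^ (α + 2)) := by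
  have hL0 : 0 < L := by linarith
  have ha1 : ‖a‖ < 1 := ha
  have hδ0 : 0 < 1 - ‖a‖ := by linarith
  have hpi := Real.pi_pos
  set u : ℂ → ℝ := fun z => (f z / (f z + L)).re
  have hu : HarmonicOnNhd u (ball 0 1) := by
    rw [← unitDisk_eq_ball]; exact harmonicOnNhd_re_div_add hf hre hL0
  have hu0 : ∀ z ∈ ball (0 : ℂ) 1, 0 ≤ u z := by
    rw [← unitDisk_eq_ball]; exact fun z hz => re_div_add_nonneg (hre z hz) hL0
  have hua : u a ≤ 1 / L := hfa ▸ re_div_add_le (hre a ha) hL0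
  have hs : ∀ z ∈ {z | z ∈ unitDisk ∧ L ≤ ‖f z‖} ∩ closedBall a (5 * (1 - ‖a‖)),
      1 - ‖z‖ ≤ 2304 * (1 - ‖a‖) / L := by
    rintro z ⟨⟨hz, hLz⟩, hza⟩
    have hz1 : ‖z‖ < 1 := hz
    have h1 := HarmonicOnNhd.mul_le_of_mem_closedBall hu hu0 ha1 hz1
      (by rwa [← mem_closedBall_iff_norm])
    have h2 : 1 / 2 ≤ u z := half_le_re_div_add (hre z hz) hL0 hLz
    have h3 : (1 - ‖z‖) * (1 / 2) ≤ 1152 * (1 - ‖a‖) * (1 / L) :=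
      (mul_le_mul_of_nonneg_left h2 (by linarith)).trans
        (h1.trans (mul_le_mul_of_nonneg_left hua (by linarith)))
    calc 1 - ‖z‖ = 2 * ((1 - ‖z‖) * (1 / 2)) := by ring
      _ ≤ 2 * (1152 * (1 - ‖a‖) * (1 / L)) := by linarith
      _ = _ := by ring
  have hmain := weightedArea_le_of_volume_circle_le hα (M := 400 * Real.pi * (1 - ‖a‖) / L)
    ((measurableSet_le_norm hf.continuousOn L).inter isClosed_closedBall.measurableSet)
    (fun z hz => hz.1.1) (s := 2304 * (1 - ‖a‖) / L) (by positivity) hs ?_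
  · refine hmain.trans (ENNReal.ofReal_le_ofReal (le_of_eq ?_))
    have hadd : ((1 - ‖a‖) / L) ^ (α + 2) = ((1 - ‖a‖) / L) ^ (α + 1) * ((1 - ‖a‖) / L) := by
      rw [← Real.rpow_add_one (by positivity)]
      congr 1
      ring
    rw [hadd, mul_div_assoc 2304, Real.mul_rpow (by norm_num) (by positivity)]
    generalize ((1 - ‖a‖) / L) ^ (α + 1) = X
    field_simp
  · intro r _ hr hr1
    have h1 : 1 - r ≤ (1 - ‖a‖) / 2 := by
      have : 2304 * (1 - ‖a‖) / L ≤ (1 - ‖a‖) / 2 := by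
        rw [div_le_div_iff₀ hL0 two_pos]; nlinarith
      linarith
    refine (measure_mono ?_).trans
      ((HarmonicOnNhd.volume_circle_le hu hu0 ha1 hr1 h1).trans (ENNReal.ofReal_le_ofReal ?_))
    · rintro θ ⟨h2, ⟨h3, h4⟩, h5⟩
      exact ⟨h2, h5, half_le_re_div_add (hre _ h3) hL0 h4⟩
    · calc 400 * Real.pi * (1 - ‖a‖) * u a ≤ 400 * Real.pi * (1 - ‖a‖) * (1 / L) := by gcongr
        _ = _ := by ring

lemma closedBall_quarter_subset {f : ℂ → ℂ} (hf : AnalyticOnNhd ℂ f unitDisk)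
    (hre : ∀ z ∈ unitDisk, 0 < (f z).re) {a : ℂ} (ha : a ∈ unitDisk) (hfa : ‖f a‖ = 1) :
    closedBall a ((1 - ‖a‖) / 4) ⊆ {z | z ∈ unitDisk ∧ 1 / 4 ≤ ‖f z‖} := by
  have ha1 : ‖a‖ < 1 := ha
  have hsub : closedBall a (3 * (1 - ‖a‖) / 4) ⊆ unitDisk := by
    intro z hz
    rw [mem_closedBall_iff_norm] at hz
    have := norm_sub_norm_le z a
    change ‖z‖ < 1
    linarith
  have hu := harmonicOnNhd_re_div_add hf hre one_pos
  intro z hz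
  have hzD : z ∈ unitDisk := hsub (closedBall_subset_closedBall (by linarith) hz)
  rw [mem_closedBall_iff_norm] at hz
  refine ⟨hzD, ?_⟩
  have h1 := HarmonicOnNhd.center_le_two_mul (fun x hx => hu x (hsub hx))
    (fun x hx => re_div_add_nonneg (hre x (hsub (sphere_subset_closedBall hx))) one_pos)
    (by linarith) (w := z) (by linarith)
  have h2 := half_le_re_div_add (hre a ha) one_pos hfa.ge
  have h3 := re_div_add_le (hre z hzD) one_pos
  simp only [div_one] at h3
  linarith

lemma min_rpow_le {α t p q : ℝ} (hp : 0 < p) (h1 : p ≤ t) (h2 : t ≤ q) :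
    min (p ^ α) (q ^ α) ≤ t ^ α := by
  rcases le_total 0 α with h | h
  · exact min_le_of_left_le (Real.rpow_le_rpow hp.le h1 h)
  · exact min_le_of_right_le (Real.rpow_le_rpow_of_nonpos (by linarith) h2 h)

lemma le_weightedArea_closedBall_quarter {α : ℝ} (hα : -1 < α) {a : ℂ} (ha : a ∈ unitDisk) :
    ENNReal.ofReal ((α + 1) * min ((3 / 4) ^ α) ((5 / 2) ^ α) / 16 * (1 - ‖a‖) ^ (α + 2)) ≤
      weightedArea α (closedBall a ((1 - ‖a‖) / 4)) := by
  have ha1 : ‖a‖ < 1 := ha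
  set δ := 1 - ‖a‖ with hδ
  have hδ0 : 0 < δ := by linarith
  have hpi := Real.pi_pos
  have hα1 : 0 < α + 1 := by linarith
  set m : ℝ := min ((3 / 4) ^ α) ((5 / 2) ^ α) with hm
  have hm0 : 0 < m := lt_min (by positivity) (by positivity)
  have hnear : ∀ z ∈ closedBall a (δ / 4), 3 * δ / 4 ≤ 1 - ‖z‖ ∧ 1 - ‖z‖ ≤ 5 * δ / 4 := by
    intro z hz
    rw [mem_closedBall_iff_norm] at hz
    have h1 := norm_sub_norm_le z a
    have h2 := norm_sub_norm_le a z
    rw [norm_sub_rev] at h2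
    constructor <;> linarith
  rw [weightedArea_eq isClosed_closedBall.measurableSet
    (fun z hz => show ‖z‖ < 1 by linarith [hnear z hz])]
  calc ENNReal.ofReal ((α + 1) * m / 16 * δ ^ (α + 2))
      = ENNReal.ofReal (1 / Real.pi * ((α + 1) * (m * δ ^ α))) * volume (closedBall a (δ / 4)) := by
        rw [Complex.volume_closedBall, ← ENNReal.ofReal_pow (by positivity),
          ← ENNReal.ofReal_coe_nnreal, NNReal.coe_real_pi, ← ENNReal.ofReal_mul (by positivity),
          ← ENNReal.ofReal_mul (by positivity), Real.rpow_add hδ0, Real.rpow_two]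
        congr 1
        field_simp
        norm_num
    _ = ∫⁻ z in closedBall a (δ / 4), ENNReal.ofReal (1 / Real.pi * ((α + 1) * (m * δ ^ α))) :=
        (setLIntegral_const _ _).symm
    _ ≤ _ := by
      refine setLIntegral_mono' isClosed_closedBall.measurableSet fun z hz => ?_
      rw [← ENNReal.ofReal_mul (by positivity)]
      refine ENNReal.ofReal_le_ofReal ?_
      obtain ⟨h1, h2⟩ := hnear z hz
      have h3 : 1 - ‖z‖ ^ 2 = (1 - ‖z‖) * (1 + ‖z‖) := by ring
      have h4 := norm_nonneg z
      have h5 : 3 / 4 ≤ (1 - ‖z‖ ^ 2) / δ := by rw [le_div_iff₀ hδ0]; nlinarith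
      have h6 : (1 - ‖z‖ ^ 2) / δ ≤ 5 / 2 := by rw [div_le_iff₀ hδ0]; nlinarith
      have h7 : m * δ ^ α ≤ (1 - ‖z‖ ^ 2) ^ α := by
        calc m * δ ^ α ≤ ((1 - ‖z‖ ^ 2) / δ) ^ α * δ ^ α := by
              gcongr; exact min_rpow_le (by norm_num) h5 h6
          _ = _ := by
            rw [← Real.mul_rpow (by linarith) hδ0.le, div_mul_cancel₀ _ hδ0.ne']
      gcongr

/-- The weak-type estimate. If `f` maps the disk analytically into the right half-plane and
`|f 0| ≤ 1`, each radius to a point where `|f|` is large meets `{|f| = 1}`, at `a` say. The closed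
balls of centre `a` and radius `1 - |a|` therefore cover `{L ≤ |f|}`; on a disjoint subfamily whose
dilates still cover, the upper bound for `{L ≤ |f|}` in the dilate and the lower bound for
`{1 / 4 ≤ |f|}` in the ball are compared term by term. -/
theorem exists_weightedArea_le_norm {α : ℝ} (hα : -1 < α) :
    ∃ C : ℝ, 0 < C ∧ ∀ f : ℂ → ℂ, AnalyticOnNhd ℂ f unitDisk →
      (∀ z ∈ unitDisk, 0 < (f z).re) → ‖f 0‖ ≤ 1 → ∀ L : ℝ, 4608 ≤ L →
        weightedArea α {z | z ∈ unitDisk ∧ L ≤ ‖f z‖} ≤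
          ENNReal.ofReal (C * (1 / L) ^ (α + 2)) *
            weightedArea α {z | z ∈ unitDisk ∧ 1 / 4 ≤ ‖f z‖} := by
  have hα1 : 0 < α + 1 := by linarith
  set A : ℝ := max 1 (2 ^ α) * 2304 ^ (α + 1) * 400 with hA
  set B : ℝ := (α + 1) * min ((3 / 4) ^ α) ((5 / 2) ^ α) / 16 with hB
  have hA0 : 0 < A := by
    have : (0 : ℝ) < max 1 (2 ^ α) := lt_max_of_lt_left one_pos
    positivity
  have hB0 : 0 < B := by
    have : (0 : ℝ) < min ((3 / 4) ^ α) ((5 / 2) ^ α) := lt_min (by positivity) (by positivity)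
    positivity
  refine ⟨A / B, by positivity, fun f hf hre hf0 L hL => ?_⟩
  have hL0 : 0 < L := by linarith
  set E := {z | z ∈ unitDisk ∧ L ≤ ‖f z‖} with hE
  set t : Set ℂ := {a | a ∈ unitDisk ∧ ‖f a‖ = 1} with ht
  obtain ⟨v, hvt, hdisj, hcov⟩ := Vitali.exists_disjoint_subfamily_covering_enlargement_closedBall
    t id (fun a => 1 - ‖a‖) 1 (fun a _ => by linarith [norm_nonneg a]) 5 (by norm_num)
  simp only [id] at hdisj hcov
  have hpos : ∀ a ∈ v, 0 < 1 - ‖a‖ := fun a ha => by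
    have : ‖a‖ < 1 := (hvt ha).1
    linarith
  have hdisj' : v.PairwiseDisjoint fun a => closedBall a ((1 - ‖a‖) / 4) :=
    hdisj.mono_on fun a ha => closedBall_subset_closedBall (by linarith [hpos a ha])
  have hcount : v.Countable := by
    refine hdisj.countable_of_nonempty_interior fun a ha => ?_
    exact ⟨a, ball_subset_interior_closedBall (mem_ball_self (hpos a ha))⟩
  have hsub : E ⊆ ⋃ a ∈ v, E ∩ closedBall a (5 * (1 - ‖a‖)) := by
    intro z hz
    have hz1 : ‖z‖ < 1 := hz.1
    have hseg : ∀ x ∈ Set.Icc (0 : ℝ) 1, (x : ℂ) * z ∈ unitDisk := fun x hx => by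
      change ‖(x : ℂ) * z‖ < 1
      rw [norm_mul, Complex.norm_real, Real.norm_of_nonneg hx.1]
      nlinarith [hx.2, norm_nonneg z]
    have hcont : ContinuousOn (fun x : ℝ => ‖f ((x : ℂ) * z)‖) (Set.Icc 0 1) :=
      (hf.continuousOn.comp (by fun_prop) hseg).norm
    obtain ⟨x, hx, hx1⟩ := intermediate_value_Icc zero_le_one hcont
      (show (1 : ℝ) ∈ _ from ⟨by simpa using hf0, by simpa using (by linarith [hz.2])⟩)
    obtain ⟨b, hb, hab⟩ := hcov ((x : ℂ) * z) ⟨hseg x hx, hx1⟩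
    refine Set.mem_biUnion hb ⟨hz, hab ?_⟩
    -- `z` is further out on the radius through `a = x z`, so `|z - a| = |z| - |a| ≤ 1 - |a|`
    have h1 : z - x * z = ((1 - x : ℝ) : ℂ) * z := by push_cast; ring
    rw [mem_closedBall_iff_norm, h1, norm_mul, norm_mul, Complex.norm_real, Complex.norm_real,
      Real.norm_of_nonneg hx.1, Real.norm_of_nonneg (by linarith [hx.2])]
    linarith
  have := hcount.to_subtype
  calc weightedArea α E ≤ weightedArea α (⋃ a ∈ v, E ∩ closedBall a (5 * (1 - ‖a‖))) :=
        measure_mono hsub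
    _ ≤ ∑' a : v, weightedArea α (E ∩ closedBall (a : ℂ) (5 * (1 - ‖(a : ℂ)‖))) :=
        measure_biUnion_le _ hcount _
    _ ≤ ∑' a : v, ENNReal.ofReal (A / B * (1 / L) ^ (α + 2)) *
          weightedArea α (closedBall (a : ℂ) ((1 - ‖(a : ℂ)‖) / 4)) := by
        refine ENNReal.tsum_le_tsum fun a => ?_
        obtain ⟨haD, hfa⟩ := hvt a.2
        have hδ := hpos a a.2
        refine (weightedArea_closedBall_le hα hf hre haD hfa hL).trans ?_
        refine le_trans (le_of_eq ?_)
          (mul_le_mul_right (le_weightedArea_closedBall_quarter hα haD) _)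
        rw [← ENNReal.ofReal_mul (by positivity), ← hA, ← hB, div_eq_mul_one_div (1 - ‖(a : ℂ)‖) L,
          Real.mul_rpow hδ.le (by positivity)]
        congr 1
        field_simp
    _ = ENNReal.ofReal (A / B * (1 / L) ^ (α + 2)) *
          weightedArea α (⋃ a ∈ v, closedBall a ((1 - ‖a‖) / 4)) := by
        rw [ENNReal.tsum_mul_left, measure_biUnion hcount hdisj'
          fun a _ => isClosed_closedBall.measurableSet]
    _ ≤ _ := by
        gcongr
        exact Set.iUnion₂_subset fun a ha => closedBall_quarter_subset hf hre (hvt ha).1 (hvt ha).2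

/-! ### Carleson windows and disks -/

lemma norm_one_sub_div_norm_mem_Icc {w : ℂ} (hw : w ≠ 0) :
    ‖1 - w / ‖w‖‖ ∈ Set.Icc (2 / Real.pi * |w.arg|) |w.arg| := by
  have hn : 0 < ‖w‖ := norm_pos_iff.2 hw
  have h1 : ‖w / ‖w‖‖ = 1 := by simp [hn.ne']
  have h2 : (w / (‖w‖ : ℂ)).arg = w.arg := by
    rw [div_eq_mul_inv, mul_comm, ← Complex.ofReal_inv, Complex.arg_real_mul _ (inv_pos.2 hn)]
  have h3 := Complex.norm_sub_mem_Icc_angle norm_one h1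
  rwa [Complex.angle_one_left (norm_pos_iff.1 (by rw [h1]; exact one_pos)), h2] at h3

lemma norm_sub_div_norm {w : ℂ} (hw : w ≠ 0) (hw1 : ‖w‖ ≤ 1) : ‖w - w / ‖w‖‖ = 1 - ‖w‖ := by
  have hn : 0 < ‖w‖ := norm_pos_iff.2 hw
  have hn' : (‖w‖ : ℂ) ≠ 0 := by exact_mod_cast hn.ne'
  have h1 : w - w / ‖w‖ = (w / ‖w‖) * ((‖w‖ - 1 : ℝ) : ℂ) := by
    push_cast; field_simp
  rw [h1, norm_mul, Complex.norm_real, norm_div, Complex.norm_real, norm_norm, div_self hn.ne',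
    one_mul, Real.norm_eq_abs, abs_sub_comm, abs_of_nonneg (by linarith)]

lemma norm_mul_conj_of_norm_eq_one {ξ : ℂ} (hξ : ‖ξ‖ = 1) (z : ℂ) :
    ‖z * (starRingEnd ℂ) ξ‖ = ‖z‖ := by
  rw [norm_mul, RCLike.norm_conj, hξ, mul_one]

/-- A Carleson window of size `h` lies in the disk of radius `2 h` about its centre. -/
lemma norm_one_sub_le_of_mem_carlesonWindow {ξ z : ℂ} {h : ℝ} (hξ : ‖ξ‖ = 1) (h1 : h < 1)
    (hz : z ∈ carlesonWindow ξ h) : ‖1 - z * (starRingEnd ℂ) ξ‖ ≤ 2 * h := by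
  obtain ⟨hzD, hzh, harg⟩ := hz
  have hzD' : ‖z‖ < 1 := hzD
  have hn := norm_mul_conj_of_norm_eq_one hξ z
  set w := z * (starRingEnd ℂ) ξ
  have hw : w ≠ 0 := norm_pos_iff.1 (by linarith)
  calc ‖1 - w‖ = ‖(1 - w / ‖w‖) - (w - w / ‖w‖)‖ := by congr 1; ring
    _ ≤ ‖1 - w / ‖w‖‖ + ‖w - w / ‖w‖‖ := norm_sub_le _ _
    _ ≤ |w.arg| + (1 - ‖w‖) := by
      rw [norm_sub_div_norm hw (by linarith)]
      gcongr
      exact (norm_one_sub_div_norm_mem_Icc hw).2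
    _ ≤ 2 * h := by linarith

/-- A Carleson window of size `h` contains the part of the unit disk within `h / 4` of its
centre. -/
lemma mem_carlesonWindow_of_norm_one_sub_le {ξ z : ℂ} {h : ℝ} (hξ : ‖ξ‖ = 1) (h0 : 0 < h)
    (h1 : h ≤ 1) (hzD : z ∈ unitDisk) (hz : ‖1 - z * (starRingEnd ℂ) ξ‖ ≤ h / 4) :
    z ∈ carlesonWindow ξ h := by
  have hzD' : ‖z‖ < 1 := hzD
  have hn := norm_mul_conj_of_norm_eq_one hξ z
  refine ⟨hzD, ?_, ?_⟩ <;> set w := z * (starRingEnd ℂ) ξ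
  all_goals
    have h2 : 1 - ‖w‖ ≤ ‖1 - w‖ := by simpa using norm_sub_norm_le 1 w
  · linarith
  · have hw : w ≠ 0 := norm_pos_iff.1 (by linarith)
    have h3 : ‖1 - w / ‖w‖‖ ≤ h / 2 := by
      calc ‖1 - w / ‖w‖‖ = ‖(1 - w) + (w - w / ‖w‖)‖ := by congr 1; ring
        _ ≤ ‖1 - w‖ + ‖w - w / ‖w‖‖ := norm_add_le _ _
        _ ≤ h / 2 := by rw [norm_sub_div_norm hw (by linarith)]; linarith
    have h4 := (norm_one_sub_div_norm_mem_Icc hw).1.trans h3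
    have hpi := Real.pi_pos
    rw [div_mul_eq_mul_div, div_le_iff₀ hpi] at h4
    nlinarith [Real.pi_le_four]

lemma carlesonWindow_mono {ξ : ℂ} {h k : ℝ} (hk : h ≤ k) :
    carlesonWindow ξ h ⊆ carlesonWindow ξ k :=
  fun _ hz => ⟨hz.1, by linarith [hz.2.1], hz.2.2.trans hk⟩

/-! ### Comparison of windows of sizes `ε h` and `h` -/

theorem mainTheorem1 (α : ℝ) (hα : -1 < α) :
    ∃ C : ℝ, 0 < C ∧
      ∀ φ : ℂ → ℂ, IsAnalyticSelfMap φ →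
        ∃ h₀ : ℝ, 0 < h₀ ∧ h₀ ≤ 1 ∧
          ∀ ε : ℝ, 0 < ε → ε < 1 →
            ∀ h : ℝ, 0 < h → h < h₀ →
              ∀ ξ : ℂ, ‖ξ‖ = 1 →
                weightedArea α {z : ℂ | z ∈ unitDisk ∧ φ z ∈ carlesonWindow ξ (ε * h)} ≤
                  ENNReal.ofReal (C * ε ^ (α + 2)) *
                    weightedArea α {z : ℂ | z ∈ unitDisk ∧ φ z ∈ carlesonWindow ξ h} := by
  obtain ⟨C, hC, hweak⟩ := exists_weightedArea_le_norm hα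
  refine ⟨C * 32 ^ (α + 2) + 147456 ^ (α + 2), by positivity, fun φ hφ => ?_⟩
  obtain ⟨hφa, hφm⟩ := hφ
  have hφ0 : ‖φ 0‖ < 1 := hφm (show (0 : ℂ) ∈ unitDisk by simp [unitDisk])
  refine ⟨1 - ‖φ 0‖, by linarith, by linarith [norm_nonneg (φ 0)], ?_⟩
  intro ε hε hε1 h hh hh0 ξ hξ
  have hh1 : h < 1 := by linarith [norm_nonneg (φ 0)]
  rcases le_or_gt (1 / 147456) ε with hbig | hsmall
  -- for `ε ≥ 1 / 147456`, where `147456 = 32 * 4608`, the factor on the right is at least `1`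
  · have h1 : 1 ≤ ENNReal.ofReal ((C * 32 ^ (α + 2) + 147456 ^ (α + 2)) * ε ^ (α + 2)) := by
      rw [ENNReal.one_le_ofReal, add_mul, ← Real.mul_rpow (by norm_num) hε.le]
      have : 1 ≤ (147456 * ε) ^ (α + 2) := Real.one_le_rpow (by linarith) (by linarith)
      have : 0 ≤ C * 32 ^ (α + 2) * ε ^ (α + 2) := by positivity
      linarith
    refine le_trans (measure_mono fun z hz => ?_) (le_mul_of_one_le_left zero_le h1)
    exact ⟨hz.1, carlesonWindow_mono (by nlinarith) hz.2⟩
  have hre1 : ∀ z ∈ unitDisk, 0 < (1 - φ z * (starRingEnd ℂ) ξ).re := fun z hz => by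
    have h1 : ‖φ z‖ < 1 := hφm hz
    have h2 := Complex.re_le_norm (φ z * (starRingEnd ℂ) ξ)
    rw [norm_mul_conj_of_norm_eq_one hξ] at h2
    rw [Complex.sub_re, Complex.one_re]
    linarith
  have hne : ∀ z ∈ unitDisk, 1 - φ z * (starRingEnd ℂ) ξ ≠ 0 := fun z hz h0 => by
    have := hre1 z hz
    simp [h0] at this
  set f : ℂ → ℂ := fun z => ((h / 16 : ℝ) : ℂ) / (1 - φ z * (starRingEnd ℂ) ξ) with hf
  have hfn : ∀ z, ‖f z‖ = h / 16 / ‖1 - φ z * (starRingEnd ℂ) ξ‖ := fun z => by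
    rw [hf, norm_div, Complex.norm_real, Real.norm_of_nonneg (by positivity)]
  have hfa : AnalyticOnNhd ℂ f unitDisk := fun z hz =>
    analyticAt_const.div (analyticAt_const.sub ((hφa z hz).mul analyticAt_const)) (hne z hz)
  have hfre : ∀ z ∈ unitDisk, 0 < (f z).re := fun z hz => by
    have h1 := Complex.normSq_pos.2 (hne z hz)
    have h2 := hre1 z hz
    rw [hf]
    simp only [Complex.div_re, Complex.ofReal_re, Complex.ofReal_im, zero_mul, zero_div, add_zero]
    positivity
  have hf0 : ‖f 0‖ ≤ 1 := by
    have h1 : 1 - ‖φ 0‖ ≤ ‖1 - φ 0 * (starRingEnd ℂ) ξ‖ := by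
      have := norm_sub_norm_le 1 (φ 0 * (starRingEnd ℂ) ξ)
      rwa [norm_mul_conj_of_norm_eq_one hξ, norm_one] at this
    rw [hfn, div_le_one (by linarith)]
    linarith
  have key := hweak f hfa hfre hf0 (1 / (32 * ε)) (by
    rw [le_div_iff₀ (by positivity)]; linarith)
  calc _ ≤ weightedArea α {z | z ∈ unitDisk ∧ 1 / (32 * ε) ≤ ‖f z‖} := by
        refine measure_mono fun z hz => ⟨hz.1, ?_⟩
        have h1 := norm_one_sub_le_of_mem_carlesonWindow hξ (by nlinarith) hz.2
        have h2 := norm_pos_iff.2 (hne z hz.1)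
        rw [hfn, div_le_div_iff₀ (by positivity) h2]
        linarith
    _ ≤ _ := key
    _ ≤ _ := by
        refine mul_le_mul' (ENNReal.ofReal_le_ofReal ?_) (measure_mono fun z hz => ⟨hz.1, ?_⟩)
        · rw [one_div_one_div, Real.mul_rpow (by norm_num) hε.le, add_mul, ← mul_assoc]
          exact le_add_of_nonneg_right (by positivity)
        · have h1 := hz.2
          have h2 := norm_pos_iff.2 (hne z hz.1)
          rw [hfn, div_le_div_iff₀ (by norm_num) h2] at h1
          exact mem_carlesonWindow_of_norm_one_sub_le hξ hh hh1.le (hφm hz.1) (by linarith)
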